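/- Let $G=(N,A)$ be a finite strongly connected directed network with node set $N$ and link set $A$, let $R,S\subseteq N$ be sets of origins and destinations, and for $r\in R$, $s\in S$, $r\neq s$, let $q^{rs}\ge 0$ be the travel demand and $K^{rs}$ the set of routes (simple directed paths) from $r$ to $s$. Put $\delta_{ak}^{rs}=1$ if route $k\in K^{rs}$ uses link $a$ and $\delta_{ak}^{rs}=0$ otherwise. Let $\Omega_1$ be the set of route-flow vectors $\mathbf f=(f_k^{rs})$ with $$\sum_{k\in K^{rs}} f_k^{rs}=q^{rs},\qquad f_k^{rs}\ge 0,$$ the link flows being defined by $v_a=\sum_{r,s,k} f_k^{rs}\delta_{ak}^{rs}$. For each flow $\mathbf f$ let $T_a$ ($a\in A$) be real random link travel times, integrable for $\mathbf f\in\Omega_1$, which may depend on $\mathbf f$, and let $T_k^{rs}=\sum_{a\in A} T_a\,\delta_{ak}^{rs}$ be the random travel time of route $k$. For $0<\alpha<1$ put $$\xi_k^{rs}(\alpha)=\min\{\xi:\Pr(T_k^{rs}\le\xi)\ge\alpha\},\quad \varphi_k^{rs}(\alpha)=E\bigl(T_k^{rs}\mid T_k^{rs}\le\xi_k^{rs}(\alpha)\bigr),\quad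 \eta_k^{rs}(\alpha)=E\bigl(T_k^{rs}\mid T_k^{rs}\ge\xi_k^{rs}(\alpha)\bigr),$$ and for $\lambda\in[0,1]$ define the combined mean travel time (CMTT) of route $k$ by $\psi_k^{rs}=\lambda\varphi_k^{rs}(\alpha)+(1-\lambda)\eta_k^{rs}(\alpha)$, and let $\boldsymbol\psi(\mathbf f)=(\psi_k^{rs})$ be the vector of the CMTTs of all routes at flow $\mathbf f$. Assume that the map $\boldsymbol\psi$ is positive (in every component) and continuous on $\Omega_1$. Then the combined mean traffic equilibrium model has at least one solution: there is $\mathbf f^*\in\Omega_1$ such that, with $\pi^{rs}=\min_{k\in K^{rs}}\psi_k^{rs}(\mathbf f^*)$, $$f_k^{rs*}\bigl(\psi_k^{rs}(\mathbf f^*)-\pi^{rs}\bigr)=0,\qquad \psi_k^{rs}(\mathbf f^*)-\pi^{rs}\ge 0,\qquad f_k^{rs*}\ge 0$$ for all $k\in K^{rs}$, $r\in R$, $s\in S$, $r\ne s$; and this $\mathbf f^*$ also solves the equivalent variational inequality $$\boldsymbol\psi(\mathbf f^*)^{T}(\mathbf f-\mathbf f^*)\ge 0\qquad\text{for all }\mathbf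 f\in\Omega_1 .$$ -/

import Mathlib

open MeasureTheory ProbabilityTheory Matrix

/-- A directed transportation network with node type `N` and link type `A`
(parallel links between the same two nodes are allowed). -/
structure TrafficNetwork (N A : Type*) where
  /-- The tail (entrance node) of a link. -/
  src : A → N
  /-- The head (exit node) of a link. -/
  tgt : A → N

namespace TrafficNetwork

variable {N A : Type*} (G : TrafficNetwork N A)

/-- Strong connectedness: every node can be reached from every node along links. -/
def StronglyConnected : Prop :=
  ∀ u v : N, Relation.ReflTransGen (fun x y => ∃ a, G.src a = x ∧ G.tgt a = y) u v

/-- `G.IsWalk r p s`: the list of links `p` leads from node `r` to node `s`. -/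
def IsWalk : N → List A → N → Prop
  | r, [], s => r = s
  | r, a :: p, s => G.src a = r ∧ IsWalk (G.tgt a) p s

/-- A route from `r` to `s` is a simple directed path: a walk that visits no node twice. -/
def IsRoute (r s : N) (p : List A) : Prop :=
  G.IsWalk r p s ∧ (r :: p.map G.tgt).Nodup

/-- The origin-destination pairs `(r, s)`, `r ∈ R`, `s ∈ S`, `r ≠ s`. -/
abbrev ODPair (R S : Set N) : Type _ :=
  {w : N × N // w.1 ∈ R ∧ w.2 ∈ S ∧ w.1 ≠ w.2}

/-- The set `K^{rs}` of all routes from `r` to `s`. -/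
abbrev RouteSet (r s : N) : Type _ := {p : List A // G.IsRoute r s p}

/-- All routes of the network: an origin-destination pair `(r, s)` with an element of `K^{rs}`. -/
abbrev Route (R S : Set N) : Type _ := Σ w : ODPair R S, G.RouteSet w.1.1 w.1.2

/-- Route-flow vectors `f = (…, f_k^{rs}, …)`. -/
abbrev RouteFlow (R S : Set N) : Type _ := G.Route R S → ℝ

instance finite_routeSet [Finite N] [Finite A] (r s : N) : Finite (G.RouteSet r s) := by
  have := Fintype.ofFinite N
  refine Set.Finite.subset (List.finite_length_le A (Fintype.card N)) ?_
  intro p hp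
  have h := hp.2.length_le_card
  simp only [List.length_cons, List.length_map] at h
  exact (Nat.le_succ _).trans h

noncomputable instance fintypeRouteSet [Finite N] [Finite A] (r s : N) :
    Fintype (G.RouteSet r s) := Fintype.ofFinite _

noncomputable instance fintypeRoute [Finite N] [Finite A] (R S : Set N) :
    Fintype (G.Route R S) := Fintype.ofFinite _

open Classical in
/-- The route-link incidence `δ_{ak}^{rs}`: `1` if route `k` uses link `a`, and `0` otherwise. -/
noncomputable def incidence {R S : Set N} (a : A) (k : G.Route R S) : ℝ :=
  if a ∈ k.2.1 then 1 else 0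

/-- The feasible region `Ω₁` in terms of route flows: demand conservation, the definitional
relation between link flows `v` and route flows, and non-negativity. -/
def feasible [Finite N] [Finite A] (R S : Set N) (q : ODPair R S → ℝ) :
    Set (G.RouteFlow R S) :=
  {f | (∀ w : ODPair R S, ∑ k : G.RouteSet w.1.1 w.1.2, f ⟨w, k⟩ = q w) ∧
    (∃ v : A → ℝ, ∀ a, v a = ∑ k : G.Route R S, f k * G.incidence a k) ∧
    ∀ k, 0 ≤ f k}

end TrafficNetwork

/-- The `α`-reliable percentile travel time `ξ(α) = min {ξ : Pr(X ≤ ξ) ≥ α}`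
(for `0 < α < 1` and a real random variable `X` the minimum is attained). -/
noncomputable def percentileTravelTime {Ω : Type*} [MeasurableSpace Ω] (P : Measure Ω)
    (X : Ω → ℝ) (α : ℝ) : ℝ :=
  sInf {x : ℝ | α ≤ P.real {ω | X ω ≤ x}}

/-- The `α`-reliable mean-below travel time `φ(α) = E(X : X ≤ ξ(α))`. -/
noncomputable def meanBelowTravelTime {Ω : Type*} [MeasurableSpace Ω] (P : Measure Ω)
    (X : Ω → ℝ) (α : ℝ) : ℝ :=
  ∫ ω, X ω ∂(cond P {ω | X ω ≤ percentileTravelTime P X α})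

/-- The `α`-reliable mean-excess travel time `η(α) = E(X : X ≥ ξ(α))`. -/
noncomputable def meanExcessTravelTime {Ω : Type*} [MeasurableSpace Ω] (P : Measure Ω)
    (X : Ω → ℝ) (α : ℝ) : ℝ :=
  ∫ ω, X ω ∂(cond P {ω | percentileTravelTime P X α ≤ X ω})

/-- The `α`-reliable combined mean travel time `ψ(α; l) = l φ(α) + (1 - l) η(α)`. -/
noncomputable def combinedMeanTravelTime {Ω : Type*} [MeasurableSpace Ω] (P : Measure Ω)
    (X : Ω → ℝ) (α l : ℝ) : ℝ :=
  l * meanBelowTravelTime P X α + (1 - l) * meanExcessTravelTime P X α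

namespace TrafficNetwork

variable {N A : Type*} (G : TrafficNetwork N A)

/-- The random travel time on route `k` at route flow `f`: the sum of the random travel times
`T f a` on its links. The link travel times may depend on the whole flow pattern `f`
(a dependence through the link flows is a special case). -/
noncomputable def routeTime [Fintype A] {R S : Set N} {Ω : Type*}
    (T : G.RouteFlow R S → A → Ω → ℝ) (f : G.RouteFlow R S) (k : G.Route R S) (ω : Ω) : ℝ :=
  ∑ a, T f a ω * G.incidence a k

/-- The route CMTT map `ψ`, taking a route flow `f` to the vector of the CMTTs of all routes. -/
noncomputable def cmtt [Fintype A] {R S : Set N} {Ω : Type*} [MeasurableSpace Ω]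
    (P : Measure Ω) (T : G.RouteFlow R S → A → Ω → ℝ) (α l : ℝ)
    (f : G.RouteFlow R S) : G.Route R S → ℝ :=
  fun k => combinedMeanTravelTime P (G.routeTime T f k) α l

/-- `f` is a combined mean traffic equilibrium with minimum travel times `π` for the route cost
map `ψ`: `f` is feasible, `π w` is the minimum of the costs of the routes of `w`, and the
complementarity conditions hold. -/
def IsCMTE [Finite N] [Finite A] {R S : Set N} (q : ODPair R S → ℝ)
    (ψ : G.RouteFlow R S → G.Route R S → ℝ) (f : G.RouteFlow R S) (π : ODPair R S → ℝ) : Prop :=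
  f ∈ G.feasible R S q ∧
  (∀ w, IsLeast (Set.range fun k : G.RouteSet w.1.1 w.1.2 => ψ f ⟨w, k⟩) (π w)) ∧
  ∀ (w : ODPair R S) (k : G.RouteSet w.1.1 w.1.2),
    f ⟨w, k⟩ * (ψ f ⟨w, k⟩ - π w) = 0 ∧ 0 ≤ ψ f ⟨w, k⟩ - π w ∧ 0 ≤ f ⟨w, k⟩

/-- `f` solves the variational inequality `ψ(f)ᵀ (g - f) ≥ 0` for all `g ∈ Ω₁`, `f ∈ Ω₁`. -/
def IsVISolution [Finite N] [Finite A] {R S : Set N} (q : ODPair R S → ℝ)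
    (ψ : G.RouteFlow R S → G.Route R S → ℝ) (f : G.RouteFlow R S) : Prop :=
  f ∈ G.feasible R S q ∧ ∀ g ∈ G.feasible R S q, 0 ≤ ψ f ⬝ᵥ (g - f)

end TrafficNetwork

/-! The equilibrium is found as a solution of the variational inequality. The feasible flows form a
compact convex set, nonempty because strong connectedness supplies a route for every pair. With `pr`
the Euclidean projection onto it, every fixed point of the continuous map `f ↦ pr (f - ψ f)` solves
the inequality, by the obtuse-angle characterization of `pr`; Brouwer's theorem provides one
(`exists_variationalInequality_solution`). Rerouting the flow of one route to another of the same
pair keeps feasibility, and testing the inequality against this shows that a used route costs no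
more than its competitors, which is complementarity (`IsVISolution.mul_sub_nonpos`).

Brouwer's theorem is derived combinatorially. A parity argument gives Scarf's lemma
(`exists_isDominant_image_eq_univ`). Applied to the lattice points of a dilated simplex, it yields
points near all colours (`exists_near_all_colors`); refining the lattice and using compactness turns
this into a KKM-type covering lemma, which applied to the sets `x i ≤ F x i` produces a fixed point
of `F`. -/

/-! ### Dominant sets and Scarf's lemma -/

/-- A finite set `σ` is dominant for a family of utilities `u` if no point is, in every
coordinate of `u`, strictly above the minimum over `σ`. -/
def IsDominant {V I : Type*} (u : I → V → ℕ) (σ : Finset V) : Prop :=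
  ∀ y, ∃ i, ∀ x ∈ σ, u i y ≤ u i x

namespace IsDominant

variable {V I : Type*} {u : I → V → ℕ}

theorem mono {σ τ : Finset V} (h : IsDominant u σ) (hτ : τ ⊆ σ) : IsDominant u τ := by
  intro y
  obtain ⟨i, hi⟩ := h y
  exact ⟨i, fun x hx => hi x (hτ hx)⟩

/-- Minimizers of the utilities over a nonempty dominant set; they exhaust the set. -/
theorem exists_minimizers [Fintype I] [DecidableEq V] {σ : Finset V} (h : IsDominant u σ)
    (hu : ∀ i, Function.Injective (u i)) (hσ : σ.Nonempty) :
    ∃ m : I → V, (∀ i, ∀ x ∈ σ, u i (m i) ≤ u i x) ∧ Finset.univ.image m = σ := by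
  have hm : ∀ i, ∃ y ∈ σ, ∀ x ∈ σ, u i y ≤ u i x := fun i => σ.exists_min_image (u i) hσ
  choose m hmem hmin using hm
  refine ⟨m, hmin, ?_⟩
  ext x
  simp only [Finset.mem_image, Finset.mem_univ, true_and]
  constructor
  · rintro ⟨i, rfl⟩
    exact hmem i
  · intro hx
    obtain ⟨i, hi⟩ := h x
    exact ⟨i, hu i (le_antisymm (hmin i x hx) (hi _ (hmem i)))⟩

/-- A dominant set with one element less than there are utilities, containing a point below all
but one of the values of the slack points `s i`, extends in exactly two ways to a dominant set
with one more element. -/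
theorem exists_two_extensions [Fintype I] [DecidableEq I] [DecidableEq V] [Fintype V]
    {τ : Finset V} (h : IsDominant u τ) (hu : ∀ i, Function.Injective (u i))
    (hτ : τ.card + 1 = Fintype.card I) {s : I → V} {t : V} (ht : t ∈ τ)
    (hts : ∀ i l, l ≠ i → u l t < u l (s i)) :
    ∃ y z, y ≠ z ∧ ∀ x, (x ∉ τ ∧ IsDominant u (insert x τ)) ↔ x = y ∨ x = z := by
  obtain ⟨m, hmin, himg⟩ := h.exists_minimizers hu ⟨t, ht⟩
  have hmem : ∀ i, m i ∈ τ := fun i => himg ▸ Finset.mem_image_of_mem m (Finset.mem_univ i)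
  have hex : ∀ x ∈ τ, ∃ i, m i = x := by
    intro x hx
    rw [← himg] at hx
    simpa using hx
  -- Pigeonhole: `m` maps `I` onto the smaller set `τ`, so two coordinates share a minimizer. The
  -- two extensions arise by releasing one or the other of them.
  obtain ⟨i, j, hij, hmij⟩ : ∃ i j, i ≠ j ∧ m i = m j := by
    by_contra! hcon
    have hinj : Function.Injective m := fun a b hab => by
      by_contra hne
      exact hcon a b hne hab
    have := Finset.card_image_of_injective Finset.univ hinj
    rw [himg, Finset.card_univ] at this
    omega
  -- the maximizer associated with dropping the coordinate `a`
  have key : ∀ a b, a ≠ b → m a = m b → ∃ y, (∀ l, l ≠ a → u l (m l) < u l y) ∧ u a y ≤ u a (m a) ∧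
      ∀ x, (x ∉ τ ∧ IsDominant u (insert x τ) ∧ ∀ l, l ≠ a → u l (m l) < u l x) ↔ x = y := by
    intro a b hab hmab
    have hne : (Finset.univ.filter fun y => ∀ l, l ≠ a → u l (m l) < u l y).Nonempty :=
      ⟨s a, by
        simp only [Finset.mem_filter, Finset.mem_univ, true_and]
        exact fun l hl => (hmin l t ht).trans_lt (hts a l hl)⟩
    -- Only a `u a`-maximal candidate can be adjoined: a candidate with larger `u a` would lie
    -- strictly above every minimum of the enlarged set.
    obtain ⟨y, hy, hymax⟩ := Finset.exists_max_image _ (u a) hne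
    simp only [Finset.mem_filter, Finset.mem_univ, true_and] at hy hymax
    have hya : u a y ≤ u a (m a) := by
      obtain ⟨l, hl⟩ := h y
      by_cases hla : l = a
      · subst hla
        exact hl _ (hmem l)
      · exact absurd (hl _ (hmem l)) (not_le.2 (hy l hla))
    refine ⟨y, hy, hya, fun x => ⟨?_, ?_⟩⟩
    · rintro ⟨-, hdom, hx⟩
      obtain ⟨l, hl⟩ := hdom y
      by_cases hla : l = a
      · subst hla
        exact hu l (le_antisymm (hymax x hx) (hl x (Finset.mem_insert_self _ _)))
      · exact absurd (hl _ (Finset.mem_insert_of_mem (hmem l))) (not_le.2 (hy l hla))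
    · rintro rfl
      refine ⟨fun hxτ => ?_, fun z => ?_, hy⟩
      · obtain ⟨l, rfl⟩ := hex x hxτ
        by_cases hla : l = a
        · subst hla
          have := hy b hab.symm
          rw [hmab] at this
          exact lt_irrefl _ this
        · exact lt_irrefl _ (hy l hla)
      · by_contra! hcon
        have hz : ∀ l, l ≠ a → u l (m l) < u l z := by
          intro l hl
          obtain ⟨w, hw, hwz⟩ := hcon l
          rcases Finset.mem_insert.1 hw with rfl | hw
          · exact (hy l hl).trans hwz
          · exact (hmin l w hw).trans_lt hwz
        obtain ⟨w, hw, hwz⟩ := hcon a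
        have := hymax z hz
        rcases Finset.mem_insert.1 hw with rfl | hw
        · omega
        · have := hmin a w hw
          omega
  obtain ⟨y, hy, hyi, hy'⟩ := key i j hij hmij
  obtain ⟨z, hz, hzj, hz'⟩ := key j i hij.symm hmij.symm
  refine ⟨y, z, ?_, fun x => ⟨?_, ?_⟩⟩
  · rintro rfl
    exact absurd (hz i hij) (not_lt.2 hyi)
  · rintro ⟨hx, hdom⟩
    -- In the enlarged set the minimizers are pairwise distinct, so `x` is the minimizer of just one
    -- coordinate. Every other coordinate keeps its old minimizer; as `i` and `j` cannot both do so,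
    -- `x` takes over one of them.
    suffices (∀ l, l ≠ i → u l (m l) < u l x) ∨ (∀ l, l ≠ j → u l (m l) < u l x) by
      rcases this with H | H
      · exact Or.inl ((hy' x).1 ⟨hx, hdom, H⟩)
      · exact Or.inr ((hz' x).1 ⟨hx, hdom, H⟩)
    obtain ⟨m', hmin', himg'⟩ := hdom.exists_minimizers hu ⟨x, Finset.mem_insert_self _ _⟩
    have hinj : Function.Injective m' := by
      have hc : (Finset.univ.image m').card = (Finset.univ : Finset I).card := by
        rw [himg', Finset.card_insert_of_notMem hx, hτ, Finset.card_univ]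
      have := Finset.card_image_iff.1 hc
      simpa [Set.injOn_univ] using this
    have hmem' : ∀ l, m' l ∈ insert x τ := fun l =>
      himg' ▸ Finset.mem_image_of_mem m' (Finset.mem_univ l)
    have hcase : ∀ l, m' l = x ∨ (m' l = m l ∧ u l (m l) < u l x) := by
      intro l
      rcases Finset.mem_insert.1 (hmem' l) with hl | hl
      · exact Or.inl hl
      · right
        have he : m' l = m l := hu l (le_antisymm
          (hmin' l _ (Finset.mem_insert_of_mem (hmem l))) (hmin l _ hl))
        refine ⟨he, lt_of_le_of_ne ?_ fun he' => hx ?_⟩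
        · rw [← he]
          exact hmin' l x (Finset.mem_insert_self _ _)
        · rw [← hu l he']
          exact hmem l
    rcases hcase i with hi | ⟨hi, -⟩
    · left
      intro l hl
      rcases hcase l with hl' | hl'
      · exact absurd (hinj (hl'.trans hi.symm)) hl
      · exact hl'.2
    · right
      rcases hcase j with hj | ⟨hj, -⟩
      · intro l hl
        rcases hcase l with hl' | hl'
        · exact absurd (hinj (hl'.trans hj.symm)) hl
        · exact hl'.2
      · exact absurd (hinj (hi.trans (hmij.trans hj.symm))) hij
  · rintro (rfl | rfl)
    · have := (hy' x).2 rfl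
      exact ⟨this.1, this.2.1⟩
    · have := (hz' x).2 rfl
      exact ⟨this.1, this.2.1⟩

end IsDominant

/-- A set with as many elements as there are colours, but not showing all colours, has an even
number of facets that show exactly the colours other than `i₀`. -/
theorem even_card_facets_of_image_ne_univ {V I : Type*} [Fintype I] [DecidableEq I]
    [DecidableEq V] (c : V → I) (i₀ : I) {ρ : Finset V} (hρ : ρ.card = Fintype.card I)
    (hc : ρ.image c ≠ Finset.univ) :
    Even (ρ.filter fun x => (ρ.erase x).image c = Finset.univ.erase i₀).card := by
  rcases Finset.eq_empty_or_nonempty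
    (ρ.filter fun x => (ρ.erase x).image c = Finset.univ.erase i₀) with he | ⟨x, hx⟩
  · simp [he]
  have hinj : ∀ x ∈ ρ, (ρ.erase x).image c = Finset.univ.erase i₀ →
      Set.InjOn c (ρ.erase x : Finset V) := by
    intro x hx h
    apply Finset.card_image_iff.1
    rw [h, Finset.card_erase_of_mem (Finset.mem_univ _), Finset.card_erase_of_mem hx, hρ,
      Finset.card_univ]
  obtain ⟨hxρ, hx⟩ := Finset.mem_filter.1 hx
  have himage : ρ.image c = insert (c x) (Finset.univ.erase i₀) := by
    rw [← hx, ← Finset.image_insert, Finset.insert_erase hxρ]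
  have hcx : c x ≠ i₀ := by
    intro h
    rw [h, Finset.insert_erase (Finset.mem_univ _)] at himage
    exact hc himage
  have hmem : c x ∈ (ρ.erase x).image c := by
    rw [hx]
    simpa using hcx
  obtain ⟨x', hx', hcx'⟩ := Finset.mem_image.1 hmem
  obtain ⟨hne, hx'ρ⟩ := Finset.mem_erase.1 hx'
  -- `x` and `x'` are the only two points of `ρ` with a common colour. A facet of the required kind
  -- is injectively coloured, hence omits one of them, and swapping them does not change the
  -- colours.
  have hset : (ρ.filter fun x => (ρ.erase x).image c = Finset.univ.erase i₀) = {x, x'} := by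
    ext y
    simp only [Finset.mem_filter, Finset.mem_insert, Finset.mem_singleton]
    constructor
    · rintro ⟨hy, hy'⟩
      by_contra! hcon
      exact hne (hinj y hy hy' (by simp [hcon.2.symm, hx'ρ]) (by simp [hcon.1.symm, hxρ]) hcx')
    · rintro (rfl | rfl)
      · exact ⟨hxρ, hx⟩
      · refine ⟨hx'ρ, ?_⟩
        rw [← hx]
        ext i
        simp only [Finset.mem_image, Finset.mem_erase]
        constructor
        · rintro ⟨z, ⟨hz, hzρ⟩, rfl⟩
          by_cases hzx : z = x
          · exact ⟨y, ⟨hne, hx'ρ⟩, by rw [hzx, hcx']⟩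
          · exact ⟨z, ⟨hzx, hzρ⟩, rfl⟩
        · rintro ⟨z, ⟨hz, hzρ⟩, rfl⟩
          by_cases hzy : z = y
          · exact ⟨x, ⟨hne.symm, hxρ⟩, by rw [hzy, hcx']⟩
          · exact ⟨z, ⟨hzy, hzρ⟩, rfl⟩
  rw [hset, Finset.card_pair hne.symm]
  exact even_two

/-- Scarf's lemma: for utilities `u i` for which the slack point `s i` is the worst point for `u i`
and better than all non-slack points for the other utilities, every colouring with `c (s i) = i`
admits a dominant set that shows every colour exactly once. -/
theorem exists_isDominant_image_eq_univ {V I : Type*} [Fintype V] [Fintype I] [DecidableEq I]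
    [DecidableEq V] [Nonempty I] {u : I → V → ℕ} (hu : ∀ i, Function.Injective (u i)) {s : I → V}
    (hs₁ : ∀ i v, v ≠ s i → u i (s i) < u i v)
    (hs₂ : ∀ i l v, l ≠ i → v ∉ Set.range s → u l v < u l (s i))
    (hV : ∃ v, v ∉ Set.range s) (c : V → I) (hc : ∀ i, c (s i) = i) :
    ∃ ρ : Finset V, ρ.card = Fintype.card I ∧ IsDominant u ρ ∧ ρ.image c = Finset.univ := by
  classical
  by_contra! hcon
  obtain ⟨i₀⟩ := ‹Nonempty I›
  have hsinj : Function.Injective s := fun a b h => by rw [← hc a, h, hc]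
  -- Incidences between rooms and doors are counted twice. If no room shows all colours, each room
  -- has an even number of doors. But the door `τ₀` of slack points lies in exactly one room, and
  -- every other door in two or none, so the total is odd.
  let rooms : Finset (Finset V) :=
    Finset.univ.filter fun ρ => ρ.card = Fintype.card I ∧ IsDominant u ρ
  let doors : Finset (Finset V) :=
    Finset.univ.filter fun τ => τ.card + 1 = Fintype.card I ∧ τ.image c = Finset.univ.erase i₀
  have hcount := Finset.sum_card_bipartiteAbove_eq_sum_card_bipartiteBelow
    (s := rooms) (t := doors) (fun ρ τ => τ ⊆ ρ)
  have hpos : 0 < Fintype.card I := Fintype.card_pos_iff.2 ⟨i₀⟩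
  have hrooms : Even (∑ ρ ∈ rooms, (doors.bipartiteAbove (fun ρ τ => τ ⊆ ρ) ρ).card) := by
    refine Finset.even_sum _ fun ρ hρ => ?_
    obtain ⟨hρc, hρd⟩ := (Finset.mem_filter.1 hρ).2
    have himg : doors.bipartiteAbove (fun ρ τ => τ ⊆ ρ) ρ =
        (ρ.filter fun x => (ρ.erase x).image c = Finset.univ.erase i₀).image ρ.erase := by
      ext τ
      simp only [Finset.mem_bipartiteAbove, doors, Finset.mem_filter, Finset.mem_univ, true_and,
        Finset.mem_image]
      constructor
      · rintro ⟨⟨hτ, hτc⟩, hsub⟩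
        have hcard : (ρ \ τ).card = 1 := by
          rw [Finset.card_sdiff_of_subset hsub]
          omega
        obtain ⟨x, hx⟩ := Finset.card_eq_one.1 hcard
        have hxm : x ∈ ρ \ τ := hx ▸ Finset.mem_singleton_self x
        have hτe : ρ.erase x = τ := by
          rw [Finset.erase_eq, ← hx, Finset.sdiff_sdiff_eq_self hsub]
        exact ⟨x, ⟨(Finset.mem_sdiff.1 hxm).1, hτe ▸ hτc⟩, hτe⟩
      · rintro ⟨x, ⟨hx, hxc⟩, rfl⟩
        refine ⟨⟨?_, hxc⟩, Finset.erase_subset _ _⟩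
        rw [Finset.card_erase_of_mem hx]
        omega
    rw [himg, Finset.card_image_of_injOn]
    · exact even_card_facets_of_image_ne_univ c i₀ hρc (hcon ρ hρc hρd)
    · exact (Finset.erase_injOn ρ).mono fun x hx => (Finset.mem_filter.1 hx).1
  have hbelow : ∀ τ ∈ doors, (rooms.bipartiteBelow (fun ρ τ => τ ⊆ ρ) τ).card =
      (Finset.univ.filter fun y => y ∉ τ ∧ IsDominant u (insert y τ)).card := by
    intro τ hτ
    obtain ⟨hτ, -⟩ := (Finset.mem_filter.1 hτ).2
    have himg : rooms.bipartiteBelow (fun ρ τ => τ ⊆ ρ) τ =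
        (Finset.univ.filter fun y => y ∉ τ ∧ IsDominant u (insert y τ)).image
          fun y => insert y τ := by
      ext ρ
      simp only [Finset.mem_bipartiteBelow, rooms, Finset.mem_filter, Finset.mem_univ, true_and,
        Finset.mem_image]
      constructor
      · rintro ⟨⟨hρ, hρd⟩, hsub⟩
        have hcard : (ρ \ τ).card = 1 := by
          rw [Finset.card_sdiff_of_subset hsub]
          omega
        obtain ⟨x, hx⟩ := Finset.card_eq_one.1 hcard
        have hxm : x ∈ ρ \ τ := hx ▸ Finset.mem_singleton_self x
        have hτe : insert x τ = ρ := by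
          rw [Finset.insert_eq, ← hx, Finset.sdiff_union_of_subset hsub]
        exact ⟨x, ⟨(Finset.mem_sdiff.1 hxm).2, hτe ▸ hρd⟩, hτe⟩
      · rintro ⟨x, ⟨hx, hxd⟩, rfl⟩
        refine ⟨⟨?_, hxd⟩, Finset.subset_insert _ _⟩
        rw [Finset.card_insert_of_notMem hx, hτ]
    rw [himg, Finset.card_image_of_injOn]
    intro x hx y hy hxy
    have hx' := (Finset.mem_filter.1 hx).2.1
    have : x ∈ insert y τ := by
      rw [← show insert x τ = insert y τ from hxy]
      exact Finset.mem_insert_self _ _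
    exact (Finset.mem_insert.1 this).resolve_right hx'
  let τ₀ : Finset V := (Finset.univ.erase i₀).image s
  have hτ₀ : τ₀ ∈ doors := by
    simp only [doors, Finset.mem_filter, Finset.mem_univ, true_and, τ₀]
    constructor
    · rw [Finset.card_image_of_injective _ hsinj, Finset.card_erase_of_mem (Finset.mem_univ _),
        Finset.card_univ]
      omega
    · rw [Finset.image_image, show c ∘ s = id from funext hc, Finset.image_id]
  have hother : ∀ τ ∈ doors.erase τ₀, Even (rooms.bipartiteBelow (fun ρ τ => τ ⊆ ρ) τ).card := by
    intro τ hτ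
    obtain ⟨hne, hτ⟩ := Finset.mem_erase.1 hτ
    rw [hbelow τ hτ]
    obtain ⟨hcard, hcol⟩ := (Finset.mem_filter.1 hτ).2
    by_cases hdom : IsDominant u τ
    -- The colours of a door made only of slack points force it to be `τ₀`; any other door contains
    -- the non-slack point needed for the two extensions.
    · obtain ⟨t, ht, hts⟩ : ∃ t ∈ τ, t ∉ Set.range s := by
        by_contra! hall
        apply hne
        apply Finset.eq_of_subset_of_card_le
        · intro x hx
          obtain ⟨i, rfl⟩ := hall x hx
          refine Finset.mem_image_of_mem s ?_
          rw [← hcol, ← hc i]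
          exact Finset.mem_image_of_mem c hx
        · have := (Finset.mem_filter.1 hτ₀).2.1
          omega
      obtain ⟨y, z, hyz, h⟩ := hdom.exists_two_extensions hu hcard ht
        fun i l hl => hs₂ i l t hl hts
      have : (Finset.univ.filter fun y => y ∉ τ ∧ IsDominant u (insert y τ)) = {y, z} := by
        ext x
        simp [h x]
      rw [this, Finset.card_pair hyz]
      exact even_two
    · rw [Finset.filter_false_of_mem]
      · simp
      · rintro x - ⟨-, hx⟩
        exact hdom (hx.mono (Finset.subset_insert _ _))
  have hone : (rooms.bipartiteBelow (fun ρ τ => τ ⊆ ρ) τ₀).card = 1 := by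
    rw [hbelow τ₀ hτ₀]
    obtain ⟨v, hv⟩ := hV
    -- The only room containing `τ₀` adjoins the non-slack point with the largest `u i₀`.
    obtain ⟨y, hy, hymax⟩ := Finset.exists_max_image
      (Finset.univ.filter fun v => v ∉ Set.range s) (u i₀) ⟨v, by simpa using hv⟩
    have hy := (Finset.mem_filter.1 hy).2
    have hslack : ∀ i, i ≠ i₀ → s i ∈ τ₀ := fun i hi =>
      Finset.mem_image_of_mem s (by simpa using hi)
    rw [Finset.card_eq_one]
    refine ⟨y, ?_⟩
    ext x
    simp only [Finset.mem_filter, Finset.mem_univ, true_and, Finset.mem_singleton]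
    constructor
    · rintro ⟨hx, hdom⟩
      obtain ⟨i, hi⟩ := hdom y
      have hlt : ∀ i, u i (s i) < u i y := fun i => hs₁ i y fun h => hy ⟨i, h.symm⟩
      by_cases hii : i = i₀
      · subst hii
        have hxy := hi x (Finset.mem_insert_self _ _)
        have hxs : x ∉ Set.range s := by
          rintro ⟨k, rfl⟩
          by_cases hk : k = i
          · subst hk
            exact absurd hxy (not_le.2 (hlt k))
          · exact hx (hslack k hk)
        exact hu i (le_antisymm (hymax x (by simpa using hxs)) hxy)
      · exact absurd (hi _ (Finset.mem_insert_of_mem (hslack i hii))) (not_le.2 (hlt i))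
    · rintro rfl
      refine ⟨fun h => ?_, fun z => ?_⟩
      · obtain ⟨i, -, hi⟩ := Finset.mem_image.1 h
        exact hy ⟨i, hi⟩
      · by_cases hz : z ∈ Set.range s
        · obtain ⟨i, rfl⟩ := hz
          refine ⟨i, fun w _ => ?_⟩
          by_cases hw : w = s i
          · rw [hw]
          · exact (hs₁ i w hw).le
        · refine ⟨i₀, fun w hw => ?_⟩
          rcases Finset.mem_insert.1 hw with rfl | hw
          · exact hymax z (by simpa using hz)
          · obtain ⟨k, hk, rfl⟩ := Finset.mem_image.1 hw
            exact (hs₂ k i₀ z (Finset.ne_of_mem_erase hk).symm hz).le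
  rw [hcount, ← Finset.add_sum_erase _ _ hτ₀, hone] at hrooms
  have := Finset.even_sum _ hother
  rw [Nat.even_add] at hrooms
  exact absurd (hrooms.2 this) (by decide)
-- From Scarf's lemma to Brouwer's fixed point theorem
/-- Discrete KKM lemma: for a colouring of the integer points of the `N`-fold simplex, there is a
point that, for each colour `i`, is close to the face `x i = 0` or to a point of colour `i`. -/
theorem exists_near_all_colors {I : Type*} [Fintype I] [Nonempty I] (N : ℕ)
    (c : (I → ℕ) → I) :
    ∃ p : I → ℕ, ∑ i, p i = N ∧ ∀ i, p i ≤ Fintype.card I ∨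
      ∃ x : I → ℕ, ∑ j, x j = N ∧ c x = i ∧
        ∀ j, x j ≤ p j + Fintype.card I ∧ p j ≤ x j + Fintype.card I := by
  classical
  let T := {x : I → ℕ // x ∈ Finset.piAntidiag Finset.univ N}
  have : Fintype T := FinsetCoe.fintype _
  have hT : ∀ x : I → ℕ, x ∈ Finset.piAntidiag Finset.univ N ↔ ∑ i, x i = N := by
    intro x
    simp [Finset.mem_piAntidiag]
  let e : T → ℕ := fun x => (Fintype.equivFin T x : ℕ)
  let B := Fintype.card T
  have heB : ∀ x, e x < B := fun x => (Fintype.equivFin T x).2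
  have heinj : Function.Injective e := fun x y h =>
    (Fintype.equivFin T).injective (Fin.ext h)
  let e' : I → ℕ := fun i => (Fintype.equivFin I i : ℕ)
  have heinj' : Function.Injective e' := fun x y h =>
    (Fintype.equivFin I).injective (Fin.ext h)
  -- Lattice points are ordered by their `i`-th coordinate, with the enumeration `e < B` breaking
  -- ties. The summand `1` keeps them above the slack value `0`, and `(N + 1) * B` lies above all
  -- their values.
  let u : I → T ⊕ I → ℕ := fun i v => match v with
    | .inl x => x.1 i * B + e x + 1
    | .inr j => if j = i then 0 else (N + 1) * B + e' j + 1
  have hle : ∀ (x : T) i, x.1 i ≤ N := by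
    intro x i
    have := (hT _).1 x.2
    exact (Finset.single_le_sum (f := x.1) (fun _ _ => Nat.zero_le _)
      (Finset.mem_univ i)).trans this.le
  have hu1 : ∀ i (x : T), u i (.inl x) < (N + 1) * B + 1 := by
    intro i x
    have h1 := Nat.mul_le_mul_right B (hle x i)
    have h2 := heB x
    simp only [u]
    nlinarith
  have hu2 : ∀ i j, j ≠ i → (N + 1) * B + 1 ≤ u i (.inr j) := by
    intro i j h
    simp only [u, if_neg h]
    omega
  have hu3 : ∀ i, u i (.inr i) = 0 := fun i => by simp [u]
  have hu4 : ∀ i (x y : T), u i (.inl x) ≤ u i (.inl y) → x.1 i ≤ y.1 i := by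
    intro i x y h
    by_contra! hlt
    have h1 := Nat.mul_le_mul_right B (Nat.succ_le_of_lt hlt)
    have h2 := heB y
    simp only [u] at h
    rw [Nat.succ_mul] at h1
    omega
  have huinj : ∀ i, Function.Injective (u i) := by
    rintro i (x | j) (y | k) h
    · have h1 := hu4 i x y h.le
      have h2 := hu4 i y x h.ge
      have h3 := le_antisymm h1 h2
      simp only [u, h3] at h
      exact congrArg _ (heinj (by omega))
    · have h1 := hu1 i x
      by_cases hk : k = i
      · subst hk
        rw [hu3] at h
        simp [u] at h
      · have := hu2 i k hk
        omega
    · have h1 := hu1 i y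
      by_cases hk : j = i
      · subst hk
        rw [hu3] at h
        simp [u] at h
      · have := hu2 i j hk
        omega
    · by_cases hj : j = i <;> by_cases hk : k = i
      · rw [hj, hk]
      · simp [u, hj, hk] at h
      · simp [u, hj, hk] at h
      · simp only [u, if_neg hj, if_neg hk] at h
        exact congrArg _ (heinj' (by omega))
  obtain ⟨i₁⟩ := ‹Nonempty I›
  have hTne : Nonempty T := ⟨⟨Pi.single i₁ N, (hT _).2 (by simp)⟩⟩
  obtain ⟨ρ, hcard, hdom, hcol⟩ := exists_isDominant_image_eq_univ (u := u) huinj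
    (s := Sum.inr)
    (by
      rintro i (x | j) hv
      · rw [hu3]
        simp [u]
      · have hj : j ≠ i := fun h => hv (by rw [h])
        have := hu2 i j hj
        rw [hu3]
        omega)
    (by
      rintro i l (x | j) hl hv
      · have := hu1 l x
        have := hu2 l i hl.symm
        omega
      · exact absurd ⟨j, rfl⟩ hv)
    (by
      obtain ⟨x⟩ := hTne
      exact ⟨.inl x, by simp⟩)
    (fun v => match v with
      | .inl x => c x.1
      | .inr j => j) (fun i => rfl)
  -- For `i` outside `C` the slack point in `ρ` has utility `0`, so dominance over lattice points
  -- can only come from coordinates in `C`; the colours in `C` must be shown by lattice points of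
  -- `ρ`.
  let C : Finset I := Finset.univ.filter fun i => Sum.inr i ∉ ρ
  have hdomC : ∀ y : T, ∃ i ∈ C, ∀ x : T, .inl x ∈ ρ → y.1 i ≤ x.1 i := by
    intro y
    obtain ⟨i, hi⟩ := hdom (.inl y)
    refine ⟨i, ?_, fun x hx => hu4 i y x (hi _ hx)⟩
    simp only [C, Finset.mem_filter, Finset.mem_univ, true_and]
    intro h
    have := hi _ h
    rw [hu3] at this
    simp [u] at this
  have hCcol : ∀ i ∈ C, ∃ x : T, .inl x ∈ ρ ∧ c x.1 = i := by
    intro i hi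
    have : i ∈ ρ.image _ := hcol ▸ Finset.mem_univ i
    obtain ⟨v, hv, hvi⟩ := Finset.mem_image.1 this
    rcases v with x | j
    · exact ⟨x, hv, hvi⟩
    · have hj : j = i := hvi
      subst hj
      exact absurd hv (Finset.mem_filter.1 hi).2
  obtain ⟨i₂, hi₂, -⟩ := hdomC hTne.some
  obtain ⟨p, hp, -⟩ := hCcol i₂ hi₂
  have hmin : ∀ i, ∃ x : T, .inl x ∈ ρ ∧ ∀ y : T, .inl y ∈ ρ → x.1 i ≤ y.1 i := by
    intro i
    obtain ⟨x, hx, hxm⟩ := Finset.exists_min_image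
      (Finset.univ.filter fun x : T => Sum.inl x ∈ ρ) (fun x => x.1 i) ⟨p, by simpa using hp⟩
    exact ⟨x, by simpa using hx, fun y hy => hxm y (by simpa using hy)⟩
  choose m hm hmle using hmin
  -- Otherwise raise each minimum over `C` by one and put the leftover mass on `i₂`: this lattice
  -- point exceeds the minima in every coordinate of `C`, against dominance.
  have hsum : N < ∑ i ∈ C, ((m i).1 i + 1) := by
    by_contra! hle
    let y : I → ℕ := fun i => (if i ∈ C then (m i).1 i + 1 else 0) +
      if i = i₂ then N - ∑ i ∈ C, ((m i).1 i + 1) else 0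
    have hy : ∑ i, y i = N := by
      rw [Finset.sum_add_distrib]
      simp only [Finset.sum_ite_mem, Finset.univ_inter, Finset.sum_ite_eq', Finset.mem_univ,
        if_true]
      omega
    obtain ⟨i, hi, h⟩ := hdomC ⟨y, (hT y).2 hy⟩
    have := h _ (hm i)
    simp only [y, if_pos hi] at this
    omega
  -- The corner with entries `m i` on `C` and `0` elsewhere lies below every lattice point of `ρ`
  -- and has coordinate sum above `N - card I`, so no coordinate can exceed it by `card I`.
  have hbound : ∀ x : T, .inl x ∈ ρ → ∀ i,
      x.1 i < (if i ∈ C then (m i).1 i else 0) + Fintype.card I := by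
    intro x hx i
    have hxN := (hT _).1 x.2
    have h1 : ∀ j, (if j ∈ C then (m j).1 j else 0) ≤ x.1 j := by
      intro j
      split_ifs
      · exact hmle j x hx
      · exact Nat.zero_le _
    have h2 : ∑ i ∈ C, ((m i).1 i + 1) ≤
        (∑ i, if i ∈ C then (m i).1 i else 0) + Fintype.card I := by
      rw [Finset.sum_add_distrib, Finset.sum_ite_mem, Finset.univ_inter]
      simp [Finset.card_le_univ]
    have h3 : ∑ j ∈ Finset.univ.erase i, (if j ∈ C then (m j).1 j else 0) ≤
        ∑ j ∈ Finset.univ.erase i, x.1 j := Finset.sum_le_sum fun j _ => h1 j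
    have h4 := Finset.add_sum_erase Finset.univ x.1 (Finset.mem_univ i)
    have h5 := Finset.add_sum_erase Finset.univ (fun j => if j ∈ C then (m j).1 j else 0)
      (Finset.mem_univ i)
    omega
  refine ⟨p.1, (hT _).1 p.2, fun i => ?_⟩
  by_cases hi : i ∈ C
  · right
    obtain ⟨x, hx, hxi⟩ := hCcol i hi
    refine ⟨x.1, (hT _).1 x.2, hxi, fun j => ?_⟩
    have h1 := hbound x hx j
    have h2 := hbound p hp j
    have h3 := hmle j x hx
    have h4 := hmle j p hp
    split_ifs at h1 h2 <;> omega
  · left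
    have := hbound p hp i
    rw [if_neg hi] at this
    omega

/-- KKM-type covering lemma: if closed sets `K i` cover the standard simplex, some point of the
simplex lies in `K i` for all `i` in its support. -/
theorem exists_mem_of_support_of_stdSimplex_subset {I : Type*} [Fintype I] [Nonempty I]
    {K : I → Set (I → ℝ)} (hK : ∀ i, IsClosed (K i)) (hcov : stdSimplex ℝ I ⊆ ⋃ i, K i) :
    ∃ p ∈ stdSimplex ℝ I, ∀ i, p i = 0 ∨ p ∈ K i := by
  have hstd : ∀ (N : ℕ) (x : I → ℕ), ∑ i, x i = N + 1 →
      (fun i => (x i : ℝ) / (N + 1)) ∈ stdSimplex ℝ I := by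
    intro N x hx
    refine ⟨fun i => by positivity, ?_⟩
    rw [← Finset.sum_div, ← Nat.cast_sum, hx]
    push_cast
    exact div_self (by positivity)
  have hstep : ∀ N : ℕ, ∃ p ∈ stdSimplex ℝ I, ∀ i, p i ≤ Fintype.card I / ((N : ℝ) + 1) ∨
      ∃ x ∈ K i, dist x p ≤ Fintype.card I / ((N : ℝ) + 1) := by
    intro N
    have hcol : ∀ x : I → ℕ, ∃ i, ∑ i, x i = N + 1 → (fun i => (x i : ℝ) / (N + 1)) ∈ K i := by
      intro x
      by_cases hx : ∑ i, x i = N + 1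
      · obtain ⟨i, hi⟩ := Set.mem_iUnion.1 (hcov (hstd N x hx))
        exact ⟨i, fun _ => hi⟩
      · exact ⟨Classical.arbitrary I, fun h => absurd h hx⟩
    choose c hc using hcol
    obtain ⟨p, hp, h⟩ := exists_near_all_colors (N + 1) c
    refine ⟨_, hstd N p hp, fun i => ?_⟩
    rcases h i with h | ⟨x, hx, hxi, hxp⟩
    · left
      have : (p i : ℝ) ≤ Fintype.card I := by exact_mod_cast h
      gcongr
    · right
      refine ⟨_, hxi ▸ hc x hx, (dist_pi_le_iff (by positivity)).2 fun j => ?_⟩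
      have h1 : (x j : ℝ) ≤ p j + Fintype.card I := by exact_mod_cast (hxp j).1
      have h2 : (p j : ℝ) ≤ x j + Fintype.card I := by exact_mod_cast (hxp j).2
      rw [Real.dist_eq, ← sub_div, abs_div, abs_of_pos (by positivity : (0 : ℝ) < N + 1)]
      gcongr
      rw [abs_le]
      constructor <;> linarith
  choose p hp h using hstep
  obtain ⟨a, ha, φ, hφ, hlim⟩ := (isCompact_stdSimplex ℝ I).tendsto_subseq hp
  have hε : Filter.Tendsto (fun N : ℕ => (Fintype.card I : ℝ) / ((φ N : ℝ) + 1))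
      Filter.atTop (nhds 0) := by
    refine Filter.Tendsto.comp (g := fun n : ℕ => (Fintype.card I : ℝ) / ((n : ℝ) + 1)) ?_
      hφ.tendsto_atTop
    exact Filter.Tendsto.const_div_atTop
      (Filter.tendsto_atTop_add_const_right _ _ tendsto_natCast_atTop_atTop) _
  refine ⟨a, ha, fun i => ?_⟩
  -- If the first alternative recurs along the subsequence, the limit coordinate vanishes; otherwise
  -- points of `K i` eventually approach `a`.
  by_cases hfreq : ∃ᶠ N in Filter.atTop, p (φ N) i ≤ Fintype.card I / ((φ N : ℝ) + 1)
  · left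
    have hlim' : Filter.Tendsto (fun N => p (φ N) i - Fintype.card I / ((φ N : ℝ) + 1))
        Filter.atTop (nhds (a i - 0)) :=
      (((continuous_apply i).tendsto a).comp hlim).sub hε
    have := isClosed_Iic.mem_of_frequently_of_tendsto
      (hfreq.mono fun N hN => Set.mem_Iic.2 (sub_nonpos.2 hN)) hlim'
    exact le_antisymm (by simpa using this) (ha.1 i)
  · right
    rw [Filter.not_frequently] at hfreq
    refine (Metric.mem_closure_iff.2 fun ε hε0 => ?_ : a ∈ closure (K i)) |> fun h =>
      (hK i).closure_eq ▸ h
    have h1 := (Metric.tendsto_nhds.1 hlim) (ε / 2) (by positivity)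
    have h2 := (hε.eventually (gt_mem_nhds (half_pos hε0)))
    obtain ⟨N, hN, hN1, hN2⟩ := (hfreq.and (h1.and h2)).exists
    obtain ⟨x, hx, hxp⟩ := (h (φ N) i).resolve_left hN
    refine ⟨x, hx, ?_⟩
    calc dist a x ≤ dist a (p (φ N)) + dist (p (φ N)) x := dist_triangle _ _ _
      _ < ε := by
        rw [dist_comm a, dist_comm _ x]
        simp only [Function.comp_apply] at hN1
        linarith

/-- Brouwer's fixed point theorem on the standard simplex. -/
theorem exists_fixedPoint_stdSimplex {I : Type*} [Fintype I] [Nonempty I]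
    {F : (I → ℝ) → I → ℝ} (hF : ContinuousOn F (stdSimplex ℝ I))
    (hmaps : Set.MapsTo F (stdSimplex ℝ I) (stdSimplex ℝ I)) :
    ∃ p ∈ stdSimplex ℝ I, F p = p := by
  -- These sets cover the simplex because `x` and `F x` have equal sums. At the point found, `p ≤ F
  -- p` coordinatewise, and the equal sums force equality.
  have hclosed : ∀ i, IsClosed {x ∈ stdSimplex ℝ I | x i ≤ F x i} := fun i =>
    (isClosed_stdSimplex ℝ I).isClosed_le (continuous_apply i).continuousOn
      ((continuous_apply i).comp_continuousOn hF)
  obtain ⟨p, hp, h⟩ := exists_mem_of_support_of_stdSimplex_subset hclosed (by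
    intro x hx
    obtain ⟨i, -, hi⟩ := Finset.exists_le_of_sum_le (s := Finset.univ) (f := x) (g := F x)
      Finset.univ_nonempty (by rw [hx.2, (hmaps hx).2])
    exact Set.mem_iUnion.2 ⟨i, hx, hi⟩)
  refine ⟨p, hp, ?_⟩
  have hle : ∀ i ∈ Finset.univ, p i ≤ F p i := by
    intro i _
    rcases h i with h | h
    · rw [h]
      exact (hmaps hp).1 i
    · exact h.2
  have := (Finset.sum_eq_sum_iff_of_le hle).1 (by rw [hp.2, (hmaps hp).2])
  exact funext fun i => (this i (Finset.mem_univ i)).symm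
-- Projection and variational inequalities
/-- The metric projection onto a closed convex set in Euclidean space, with its variational
characterization and continuity, in coordinates. -/
theorem exists_continuous_projection {ι : Type*} [Fintype ι] {K : Set (ι → ℝ)}
    (hne : K.Nonempty) (hcl : IsClosed K) (hcv : Convex ℝ K) :
    ∃ pr : (ι → ℝ) → ι → ℝ, Continuous pr ∧ (∀ x, pr x ∈ K) ∧
      ∀ x, ∀ g ∈ K, (x - pr x) ⬝ᵥ (g - pr x) ≤ 0 := by
  let e := EuclideanSpace.equiv ι ℝ
  let K' : Set (EuclideanSpace ℝ ι) := e ⁻¹' K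
  have hK'ne : K'.Nonempty := by
    obtain ⟨x, hx⟩ := hne
    exact ⟨e.symm x, by simpa [K'] using hx⟩
  have hK'cv : Convex ℝ K' := hcv.linear_preimage e.toLinearEquiv.toLinearMap
  have hK'cl : IsClosed K' := hcl.preimage e.continuous
  have hex := exists_norm_eq_iInf_of_complete_convex hK'ne hK'cl.isComplete hK'cv
  choose P hPK hP using hex
  have hvar : ∀ x, ∀ g ∈ K', inner ℝ (x - P x) (g - P x) ≤ 0 := fun x =>
    (norm_eq_iInf_iff_real_inner_le_zero hK'cv (hPK x)).1 (hP x)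
  have hlip : LipschitzWith 1 P := by
    refine LipschitzWith.of_dist_le_mul fun x y => ?_
    rw [dist_eq_norm, dist_eq_norm, NNReal.coe_one, one_mul]
    have h1 := hvar x _ (hPK y)
    have h2 := hvar y _ (hPK x)
    -- The sum of the two obtuse-angle inequalities; Cauchy–Schwarz then makes `P` nonexpansive.
    have h3 : inner ℝ (P x - P y) (P x - P y) ≤ inner ℝ (x - y) (P x - P y) := by
      simp only [inner_sub_left, inner_sub_right] at h1 h2 ⊢
      linarith
    rw [real_inner_self_eq_norm_sq] at h3
    have h4 := real_inner_le_norm (x - y) (P x - P y)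
    by_contra! hlt
    nlinarith [norm_nonneg (P x - P y), norm_nonneg (x - y)]
  refine ⟨fun x => e (P (e.symm x)),
    e.continuous.comp (hlip.continuous.comp e.symm.continuous), fun x => hPK _, ?_⟩
  intro x g hg
  have := hvar (e.symm x) (e.symm g) (by simpa [K'] using hg)
  rw [PiLp.inner_apply] at this
  refine le_of_eq_of_le ?_ this
  simp only [dotProduct]
  refine Finset.sum_congr rfl fun i _ => ?_
  simp [e, mul_comm]

/-- Hartman–Stampacchia: a continuous map on a nonempty closed convex set, contained in a multiple
of the solid simplex, admits a solution of the variational inequality. -/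
theorem exists_variationalInequality_solution {ι : Type*} [Fintype ι] {K : Set (ι → ℝ)}
    (hne : K.Nonempty) (hcl : IsClosed K) (hcv : Convex ℝ K) {M : ℝ} (hM : 0 < M)
    (hnonneg : ∀ x ∈ K, ∀ i, 0 ≤ x i) (hsum : ∀ x ∈ K, ∑ i, x i ≤ M)
    {ψ : (ι → ℝ) → ι → ℝ} (hψ : ContinuousOn ψ K) :
    ∃ f ∈ K, ∀ g ∈ K, 0 ≤ ψ f ⬝ᵥ (g - f) := by
  obtain ⟨pr, hcont, hmem, hvar⟩ := exists_continuous_projection hne hcl hcv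
  -- The extra coordinate `none` absorbs the slack in `∑ i, x i ≤ M`, placing `K` in a standard
  -- simplex. Projecting in `ret` lets Brouwer's theorem act on the whole simplex.
  let emb : (ι → ℝ) → Option ι → ℝ := fun x o => o.elim (1 - (∑ i, x i) / M) fun i => x i / M
  let ret : (Option ι → ℝ) → ι → ℝ := fun y => pr fun i => M * y (some i)
  let step : (ι → ℝ) → ι → ℝ := fun x => pr (x - ψ x)
  have hemb : Continuous emb := by
    refine continuous_pi fun o => ?_
    cases o <;> simp only [emb, Option.elim] <;> fun_prop
  have hret : Continuous ret := by
    refine hcont.comp ?_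
    fun_prop
  have hstep : ContinuousOn step K := hcont.comp_continuousOn (continuousOn_id.sub hψ)
  obtain ⟨y, -, hy⟩ := exists_fixedPoint_stdSimplex (F := fun y => emb (step (ret y)))
    (hemb.comp_continuousOn (hstep.comp hret.continuousOn fun y _ => hmem _))
    (by
      intro y _
      have hK : step (ret y) ∈ K := hmem _
      refine ⟨fun o => ?_, ?_⟩
      · cases o with
        | none =>
          simp only [emb, Option.elim, sub_nonneg]
          exact (div_le_one hM).2 (hsum _ hK)
        | some i => exact div_nonneg (hnonneg _ hK i) hM.le
      · rw [Fintype.sum_option]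
        simp only [emb, Option.elim]
        rw [← Finset.sum_div]
        ring)
  have hyf : (fun i => M * y (some i)) = step (ret y) := by
    funext i
    rw [← congrFun hy (some i)]
    simp only [emb, Option.elim]
    field_simp
  have hproj : ∀ x ∈ K, pr x = x := by
    intro x hx
    have h := hvar x x hx
    have h0 : (x - pr x) ⬝ᵥ (x - pr x) = 0 := le_antisymm h
      (Finset.sum_nonneg fun i _ => mul_self_nonneg _)
    exact (sub_eq_zero.1 (dotProduct_self_eq_zero.1 h0)).symm
  -- The fixed point `y` already decodes to a point of `K`, so the projection in `ret` leaves it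
  -- unchanged.
  have hfix : step (ret y) = ret y := by
    have : ret y = pr (step (ret y)) := by rw [← hyf]
    exact (this.trans (hproj _ (hmem _))).symm
  refine ⟨ret y, hmem _, fun g hg => ?_⟩
  have h := hvar (ret y - ψ (ret y)) g hg
  rw [show pr (ret y - ψ (ret y)) = ret y from hfix] at h
  rw [sub_sub_cancel_left, neg_dotProduct] at h
  linarith
-- Routes, the feasible set and the equilibrium
namespace TrafficNetwork

variable {N A : Type*} (G : TrafficNetwork N A)

/-- Cutting the initial part of a route: every node on a route starts a route to the same end. -/
theorem exists_isRoute_of_mem {s : N} : ∀ {r b : N} {p : List A}, G.IsRoute b s p →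
    r ∈ b :: p.map G.tgt → ∃ p', G.IsRoute r s p'
  | r, b, [], h, hr => by
    obtain rfl : r = b := by simpa using hr
    exact ⟨[], h⟩
  | r, b, a :: p, h, hr => by
    rcases List.mem_cons.1 hr with rfl | hr
    · exact ⟨_, h⟩
    · exact exists_isRoute_of_mem ⟨h.1.2, (List.nodup_cons.1 h.2).2⟩ hr

/-- Links are prepended to a route one at a time; if the new node already lies on the route, the
route is cut there instead, so it stays simple. -/
theorem StronglyConnected.exists_isRoute {G : TrafficNetwork N A} (hG : G.StronglyConnected)
    (r s : N) : ∃ p, G.IsRoute r s p := by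
  induction hG r s using Relation.ReflTransGen.head_induction_on with
  | refl => exact ⟨[], rfl, by simp⟩
  | @head r b hrb _ ih =>
    obtain ⟨a, ha, hb⟩ := hrb
    obtain ⟨p, hp⟩ := ih
    by_cases hr : r ∈ b :: p.map G.tgt
    · exact G.exists_isRoute_of_mem hp hr
    · subst hb
      exact ⟨a :: p, ⟨ha, hp.1⟩, List.nodup_cons.2 ⟨hr, hp.2⟩⟩

variable {G} [Finite N] [Finite A] {R S : Set N} {q : ODPair R S → ℝ}

/-- The link-flow clause merely defines `v`, so it can always be met. -/
theorem mem_feasible_iff {f : G.RouteFlow R S} : f ∈ G.feasible R S q ↔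
    (∀ w : ODPair R S, ∑ k : G.RouteSet w.1.1 w.1.2, f ⟨w, k⟩ = q w) ∧ ∀ k, 0 ≤ f k :=
  ⟨fun h => ⟨h.1, h.2.2⟩, fun h => ⟨h.1, ⟨_, fun _ => rfl⟩, h.2⟩⟩

theorem isClosed_feasible : IsClosed (G.feasible R S q) := by
  have : G.feasible R S q =
      (⋂ w : ODPair R S, {f | ∑ k : G.RouteSet w.1.1 w.1.2, f ⟨w, k⟩ = q w}) ∩
        ⋂ k, {f | 0 ≤ f k} := by
    ext f
    simp [mem_feasible_iff]
  rw [this]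
  refine (isClosed_iInter fun w => isClosed_eq ?_ continuous_const).inter
    (isClosed_iInter fun k => isClosed_le continuous_const (continuous_apply k))
  fun_prop

theorem convex_feasible : Convex ℝ (G.feasible R S q) := by
  intro f hf g hg a b ha hb hab
  rw [mem_feasible_iff] at hf hg ⊢
  refine ⟨fun w => ?_, fun k => add_nonneg (mul_nonneg ha (hf.2 k)) (mul_nonneg hb (hg.2 k))⟩
  simp only [Pi.add_apply, Pi.smul_apply, smul_eq_mul, Finset.sum_add_distrib, ← Finset.mul_sum,
    hf.1 w, hg.1 w]
  rw [← add_mul, hab, one_mul]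

theorem nonempty_feasible (hG : G.StronglyConnected) (hq : ∀ w, 0 ≤ q w) :
    (G.feasible R S q).Nonempty := by
  classical
  choose p hp using hG.exists_isRoute
  -- All demand of a pair is sent along one chosen route.
  refine ⟨fun k => if k.2 = ⟨_, hp k.1.1.1 k.1.1.2⟩ then q k.1 else 0,
    mem_feasible_iff.2 ⟨fun w => ?_, fun k => ?_⟩⟩
  · rw [Finset.sum_eq_single (⟨_, hp w.1.1 w.1.2⟩ : G.RouteSet w.1.1 w.1.2)]
    · exact if_pos rfl
    · exact fun k _ hk => if_neg hk
    · exact fun h => absurd (Finset.mem_univ _) h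
  · split_ifs
    exacts [hq _, le_rfl]

theorem le_demand_of_mem_feasible {f : G.RouteFlow R S} (hf : f ∈ G.feasible R S q)
    (k : G.Route R S) : f k ≤ q k.1 := by
  rw [mem_feasible_iff] at hf
  rw [← hf.1 k.1]
  exact Finset.single_le_sum (f := fun j => f ⟨k.1, j⟩) (fun j _ => hf.2 _) (Finset.mem_univ k.2)

/-- A feasible flow satisfying the variational inequality uses only routes of minimal cost. -/
theorem IsVISolution.mul_sub_nonpos {ψ : G.RouteFlow R S → G.Route R S → ℝ}
    {f : G.RouteFlow R S} (h : G.IsVISolution q ψ f) (w : ODPair R S)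
    (k j : G.RouteSet w.1.1 w.1.2) : f ⟨w, k⟩ * (ψ f ⟨w, k⟩ - ψ f ⟨w, j⟩) ≤ 0 := by
  classical
  obtain ⟨hf, hvi⟩ := h
  rcases eq_or_ne k j with rfl | hkj
  · simp
  have hf' := mem_feasible_iff.1 hf
  -- The test direction moves the entire flow of `k` to `j`; demand is preserved and the flow on `k`
  -- drops exactly to zero.
  let d : G.RouteFlow R S := Pi.single ⟨w, j⟩ (f ⟨w, k⟩) - Pi.single ⟨w, k⟩ (f ⟨w, k⟩)
  have hd : f + d ∈ G.feasible R S q := by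
    refine mem_feasible_iff.2 ⟨fun w' => ?_, fun i => ?_⟩
    · simp only [Pi.add_apply, Finset.sum_add_distrib, hf'.1 w', d, Pi.sub_apply,
        Finset.sum_sub_distrib]
      have hsingle : ∀ i : G.RouteSet w.1.1 w.1.2,
          ∑ x : G.RouteSet w'.1.1 w'.1.2, (Pi.single ⟨w, i⟩ (f ⟨w, k⟩) : G.RouteFlow R S) ⟨w', x⟩ =
            if w' = w then f ⟨w, k⟩ else 0 := by
        intro i
        split_ifs with hw
        · subst hw
          rw [Finset.sum_eq_single i]
          · simp
          · intro x _ hx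
            exact Pi.single_eq_of_ne (fun h => hx (by simpa using h)) _
          · simp
        · refine Finset.sum_eq_zero fun x _ => Pi.single_eq_of_ne (fun h => hw ?_) _
          exact congrArg Sigma.fst h
      rw [hsingle, hsingle, sub_self, add_zero]
    · have h0 := hf'.2 i
      have hk := hf'.2 ⟨w, k⟩
      simp only [d, Pi.add_apply, Pi.sub_apply, Pi.single_apply]
      split_ifs with h1 h2 h2
      · linarith
      · linarith
      · rw [h2]
        linarith
      · linarith
  have := hvi _ hd
  rw [add_sub_cancel_left, dotProduct_sub, dotProduct_single, dotProduct_single] at this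
  linarith

/-- A solution of the variational inequality is an equilibrium. -/
theorem IsVISolution.exists_isCMTE {ψ : G.RouteFlow R S → G.Route R S → ℝ}
    {f : G.RouteFlow R S} (h : G.IsVISolution q ψ f) (hG : G.StronglyConnected) :
    ∃ π, G.IsCMTE q ψ f π := by
  have hmin : ∀ w : ODPair R S, ∃ j : G.RouteSet w.1.1 w.1.2, ∀ k : G.RouteSet w.1.1 w.1.2,
      ψ f ⟨w, j⟩ ≤ ψ f ⟨w, k⟩ := by
    intro w
    obtain ⟨p, hp⟩ := hG.exists_isRoute w.1.1 w.1.2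
    have : Nonempty (G.RouteSet w.1.1 w.1.2) := ⟨⟨p, hp⟩⟩
    exact Finite.exists_min fun k : G.RouteSet w.1.1 w.1.2 => ψ f ⟨w, k⟩
  choose j hj using hmin
  refine ⟨fun w => ψ f ⟨w, j w⟩, h.1,
    fun w => ⟨⟨j w, rfl⟩, by rintro _ ⟨k, rfl⟩; exact hj w k⟩, fun w k => ?_⟩
  have hk := (mem_feasible_iff.1 h.1).2 ⟨w, k⟩
  have hs := sub_nonneg.2 (hj w k)
  exact ⟨le_antisymm (h.mul_sub_nonpos w k (j w)) (mul_nonneg hk hs), hs, hk⟩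

/-- Existence of solutions of the variational inequality for continuous route costs. -/
theorem exists_isVISolution {ψ : G.RouteFlow R S → G.Route R S → ℝ}
    (hG : G.StronglyConnected) (hq : ∀ w, 0 ≤ q w)
    (hψ : ContinuousOn ψ (G.feasible R S q)) : ∃ f, G.IsVISolution q ψ f := by
  obtain ⟨f, hf, h⟩ := exists_variationalInequality_solution (nonempty_feasible hG hq)
    -- Each route carries at most the demand of its pair, so the demands summed over routes bound
    -- the total flow; the `1` keeps `M` positive when this sum is zero.
    isClosed_feasible convex_feasible (M := ∑ k : G.Route R S, q k.1 + 1)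
    (add_pos_of_nonneg_of_pos (Finset.sum_nonneg fun k _ => hq _) one_pos)
    (fun f hf => (mem_feasible_iff.1 hf).2)
    (fun f hf => (Finset.sum_le_sum fun k _ => le_demand_of_mem_feasible hf k).trans (by linarith))
    hψ
  exact ⟨f, hf, h⟩

end TrafficNetwork

theorem proposition3 {N A Ω : Type*} [Fintype N] [Fintype A] [MeasurableSpace Ω]
    (G : TrafficNetwork N A) (hG : G.StronglyConnected)
    (R S : Set N) (q : TrafficNetwork.ODPair R S → ℝ) (hq : ∀ w, 0 ≤ q w)
    (P : Measure Ω) [IsProbabilityMeasure P]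
    (T : G.RouteFlow R S → A → Ω → ℝ)
    (hT : ∀ f ∈ G.feasible R S q, ∀ a, Integrable (T f a) P)
    (α l : ℝ) (hα : 0 < α ∧ α < 1) (hl : 0 ≤ l ∧ l ≤ 1)
    (hpos : ∀ f ∈ G.feasible R S q, ∀ k, 0 < G.cmtt P T α l f k)
    (hcont : ContinuousOn (G.cmtt P T α l) (G.feasible R S q)) :
    ∃ (f : G.RouteFlow R S) (π : TrafficNetwork.ODPair R S → ℝ),
      G.IsCMTE q (G.cmtt P T α l) f π ∧ G.IsVISolution q (G.cmtt P T α l) f := by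
  obtain ⟨f, hf⟩ := TrafficNetwork.exists_isVISolution hG hq hcont
  obtain ⟨π, hπ⟩ := hf.exists_isCMTE hG
  exact ⟨f, π, hπ, hf⟩
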